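/- Work over $\mathbb{C}$ with $\mathbf{x}=(x_1,x_2)$. For forms $F,G$ of orders $p,q$ in $\mathbf{x}$ and $k\le\min(p,q)$ let $$(F,G)_k=\frac{(p-k)!\,(q-k)!}{p!\,q!}\sum_{i=0}^{k}(-1)^i\binom{k}{i}\frac{\partial^k F}{\partial x_1^{k-i}\partial x_2^{i}}\,\frac{\partial^k G}{\partial x_1^{i}\partial x_2^{k-i}}$$ be the $k$-th transvectant. For a binary quartic $Q$ put $S(Q)=\frac12(Q,Q)_4$ and $T(Q)=\frac16\bigl(Q,(Q,Q)_2\bigr)_4$. For a binary quintic $F$ put $C_1=(F,F)_4$, $C_2=(F,C_1)_2$, $C_3=(C_2,C_2)_2$, and $$J=-\tfrac12(C_1,C_1)_2,\qquad K=\tfrac18(C_1,C_3)_2,\qquad L=\tfrac1{96}(C_3,C_3)_2 .$$ Write $F(\mathbf{x})=\prod_{l=1}^5(\mathbf{x}\lambda_l)$ in terms of homogeneous roots $\lambda_l=(\lambda_{l,1},\lambda_{l,2})\in\mathbb{C}^2$, where $(\mathbf{x}\lambda_l)=x_1\lambda_{l,2}-x_2\lambda_{l,1}$, let $Q_i(\mathbf{x})=\prod_{l\ne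 i}(\mathbf{x}\lambda_l)$, and define $\mathcal{B}_0(F),\dots,\mathcal{B}_5(F)$ by $$\prod_{i=1}^5\Bigl(\bigl(S(Q_i)^3-27\,T(Q_i)^2\bigr)z-S(Q_i)^3\Bigr)=\sum_{i=0}^5\mathcal{B}_i(F)\,z^{5-i}.$$ **Proposition.** For every binary quintic $F$, and every choice of the homogeneous roots of $F$, $$\mathcal{B}_0(F)=\frac{5^{15}}{2^{40}}\left\{-2^{21}K^3+2^{14}\cdot3\,K^2J^2-2^7\cdot3\,KJ^4+J^6\right\},$$ $$\mathcal{B}_1(F)=\frac{5^{16}}{2^{35}\cdot3^3}\left\{2^{16}\cdot7\,K^3-2^{10}\cdot23\,K^2J^2+2^2\cdot71\,KJ^4-J^6\right\},$$ $$\mathcal{B}_2(F)=\frac{5^{16}}{2^{30}\cdot3^6}\left\{2^{11}\cdot5^3\,LKJ-2^4\cdot5^3\,LJ^3-2^{15}\cdot3\,K^3+2^7\cdot11\cdot13\,K^2J^2-3\cdot131\,KJ^4+2J^6\right\},$$ $$\mathcal{B}_3(F)=\frac{5^{16}}{2^{25}\cdot3^9}\left\{-2^{11}\cdot5^4\,L^2-2^9\cdot3\cdot5^3\,LKJ+2\cdot5^3\cdot11\,LJ^3+2^9\cdot17\,K^3-2^2\cdot23\cdot37\,K^2J^2+3^5\,KJ^4-2J^6\right\},$$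 $$\mathcal{B}_4(F)=\frac{5^{16}}{2^{22}\cdot3^{12}}\left\{-2^5\cdot3^2\cdot5^3\,LKJ-5^3\cdot29\,LJ^3-2^7\cdot11\,K^3-7^2\cdot83\,K^2J^2-2^2\cdot59\,KJ^4+2^2J^6\right\},$$ $$\mathcal{B}_5(F)=\frac{5^{15}}{2^{15}\cdot3^{15}}\left\{3^3K^3-3^3K^2J^2+3^2KJ^4-J^6\right\}.$$ -/

import Mathlib

namespace BinaryForms

noncomputable section

/-- Polynomials in the two variables `x₁ = X 0`, `x₂ = X 1` over `ℂ`. A binary form of order `p` is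
such a polynomial that is homogeneous of degree `p`. -/
abbrev Form : Type := MvPolynomial (Fin 2) ℂ

/-- The bracket `(x ξ) = x₁ ξ₂ - x₂ ξ₁`, a linear form in `x` with homogeneous root `ξ`. -/
def bracket (ξ : Fin 2 → ℂ) : Form :=
  MvPolynomial.X 0 * MvPolynomial.C (ξ 1) - MvPolynomial.X 1 * MvPolynomial.C (ξ 0)

/-- The partial derivative `∂^(a+b) F / ∂x₁^a ∂x₂^b`. -/
def partialD (a b : ℕ) (F : Form) : Form :=
  (MvPolynomial.pderiv (0 : Fin 2))^[a] ((MvPolynomial.pderiv (1 : Fin 2))^[b] F)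

/-- The `k`-th transvectant `(F, G)_k` of a form `F` of order `p` and a form `G` of order `q`
(`k ≤ p`, `k ≤ q`); it is a form of order `p + q - 2 k`. -/
def transvectant (p q k : ℕ) (F G : Form) : Form :=
  MvPolynomial.C (((p - k).factorial * (q - k).factorial : ℂ) / (p.factorial * q.factorial : ℂ)) *
    ∑ i ∈ Finset.range (k + 1),
      MvPolynomial.C ((-1 : ℂ) ^ i * (k.choose i : ℂ)) *
        (partialD (k - i) i F * partialD i (k - i) G)

/-- The complex number that a form of order zero is. -/
def value (F : Form) : ℂ := MvPolynomial.constantCoeff F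

/-- The invariant `S(Q) = (1/2) (Q, Q)_4` of a binary quartic. -/
def quarticS (Q : Form) : ℂ := 1 / 2 * value (transvectant 4 4 4 Q Q)

/-- The invariant `T(Q) = (1/6) (Q, (Q, Q)_2)_4` of a binary quartic. -/
def quarticT (Q : Form) : ℂ :=
  1 / 6 * value (transvectant 4 4 4 Q (transvectant 4 4 2 Q Q))

/-- The covariant `C₁ = (F, F)_4` of a binary quintic, of order `2`. -/
def covC1 (F : Form) : Form := transvectant 5 5 4 F F

/-- The covariant `C₂ = (F, C₁)_2` of a binary quintic, of order `3`. -/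
def covC2 (F : Form) : Form := transvectant 5 2 2 F (covC1 F)

/-- The covariant `C₃ = (C₂, C₂)_2` of a binary quintic, of order `2`. -/
def covC3 (F : Form) : Form := transvectant 3 3 2 (covC2 F) (covC2 F)

/-- The invariant `J = -(1/2) (C₁, C₁)_2` of a binary quintic, of degree `4`. -/
def invJ (F : Form) : ℂ := -(1 / 2) * value (transvectant 2 2 2 (covC1 F) (covC1 F))

/-- The invariant `K = (1/8) (C₁, C₃)_2` of a binary quintic, of degree `8`. -/
def invK (F : Form) : ℂ := 1 / 8 * value (transvectant 2 2 2 (covC1 F) (covC3 F))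

/-- The invariant `L = (1/96) (C₃, C₃)_2` of a binary quintic, of degree `12`. -/
def invL (F : Form) : ℂ := 1 / 96 * value (transvectant 2 2 2 (covC3 F) (covC3 F))

/-- The binary quintic `F(x) = (x λ₁) ⋯ (x λ₅)` with homogeneous roots `λ₁, …, λ₅`. -/
def quinticOfRoots (lam : Fin 5 → Fin 2 → ℂ) : Form := ∏ l, bracket (lam l)

/-- The quartic `Q_i(x)`: the product of the `(x λ_l)` over `l ≠ i`. -/
def quarticOmit (lam : Fin 5 → Fin 2 → ℂ) (i : Fin 5) : Form :=
  ∏ l ∈ Finset.univ.erase i, bracket (lam l)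

/-- The polynomial in the variable `z`
`∏ i, ((S(Q_i)³ - 27 T(Q_i)²) z - S(Q_i)³)`. -/
def Rbar (lam : Fin 5 → Fin 2 → ℂ) : Polynomial ℂ :=
  ∏ i, (Polynomial.C (quarticS (quarticOmit lam i) ^ 3 - 27 * quarticT (quarticOmit lam i) ^ 2) *
      Polynomial.X - Polynomial.C (quarticS (quarticOmit lam i) ^ 3))

/-- `𝓑_i`, the coefficient of `z^(5-i)` in `Rbar`, for `0 ≤ i ≤ 5`. -/
def calB (i : Fin 6) (lam : Fin 5 → Fin 2 → ℂ) : ℂ := (Rbar lam).coeff (5 - (i : ℕ))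

end

end BinaryForms

/-!
A linear substitution of determinant `d` carries the roots `λ_l` to new roots, multiplies `J, K, L`
by `d ^ 10, d ^ 20, d ^ 30`, and multiplies `S(Q_i), T(Q_i)` by `d ^ 4, d ^ 6`, hence each `𝓑_i` by
`d ^ 60`. The claimed relations are isobaric for these weights, so they hold for a system of
roots as soon as they hold for a system from which it arises by a substitution, even a singular
one (`RelationsHold.substRoot`). The equivariance is the chain rule: it is enough to know it for the
transvectants of index two and four, where it is an identity in the partial derivatives of order two
and four.

If two of the `λ_l` are linearly independent, a substitution moves them to `0` and `∞`, and the
quintic becomes `x₁ x₂` times a cubic with coefficients `c₀, c₁, c₂, c₃`. If not, all `λ_l` are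
multiples of one vector, they arise by a singular substitution, and everything vanishes.

For the normal form, `J, K, L` are short polynomials in the `c_i`. Of the five factors of `Rbar`,
the two that omit the root `0` or `∞` are polynomials in the `c_i` as well. The other three belong
to quartics `x₁ x₂ q` with `q` the product of two of the factors of the cubic. If `δ` is the
discriminant of `q` and `m` the product of its outer coefficients, then
`S ^ 3 = (δ + m) ^ 3 / 12 ^ 3` and `S ^ 3 - 27 T ^ 2 = m ^ 2 δ / 256`.
The coefficients of the product of these three factors are symmetric in the roots of the cubic and
are expressed by the `c_i` first (`prod_disc_eq`, `sum_disc_disc_cube_eq`, `sum_disc_cube_cube_eq`,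
`prod_cube_eq`); what remains are six identities between polynomials in `c₀, c₁, c₂, c₃`.
-/

namespace BinaryForms

open MvPolynomial

/-! ### Equivariance of transvectants -/

/-- The substitution `P(x₁, x₂) ↦ P((x ξ), (x η))`. -/
noncomputable def bracketSubst (ξ η : Fin 2 → ℂ) : Form →ₐ[ℂ] Form :=
  aeval ![bracket ξ, bracket η]

/-- The determinant of the linear substitution `bracketSubst ξ η`. -/
def bracketDet (ξ η : Fin 2 → ℂ) : ℂ := ξ 0 * η 1 - ξ 1 * η 0

lemma pderiv_zero_bracket (ξ : Fin 2 → ℂ) : pderiv 0 (bracket ξ) = C (ξ 1) := by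
  simp [bracket, pderiv_X]

lemma pderiv_one_bracket (ξ : Fin 2 → ℂ) : pderiv 1 (bracket ξ) = -C (ξ 0) := by
  simp [bracket, pderiv_X]

lemma pderiv_zero_bracketSubst (ξ η : Fin 2 → ℂ) (P : Form) :
    pderiv 0 (bracketSubst ξ η P) =
      C (ξ 1) * bracketSubst ξ η (pderiv 0 P) + C (η 1) * bracketSubst ξ η (pderiv 1 P) := by
  induction P using MvPolynomial.induction_on with
  | C a => simp [bracketSubst]
  | add p q hp hq => simp only [map_add, hp, hq]; ring
  | mul_X p i hp =>
    fin_cases i <;>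
      simp [bracketSubst, pderiv_X, pderiv_zero_bracket] at hp ⊢ <;> rw [hp] <;> ring

lemma pderiv_one_bracketSubst (ξ η : Fin 2 → ℂ) (P : Form) :
    pderiv 1 (bracketSubst ξ η P) =
      -(C (ξ 0) * bracketSubst ξ η (pderiv 0 P) + C (η 0) * bracketSubst ξ η (pderiv 1 P)) := by
  induction P using MvPolynomial.induction_on with
  | C a => simp [bracketSubst]
  | add p q hp hq => simp only [map_add, hp, hq]; ring
  | mul_X p i hp =>
    fin_cases i <;>
      simp [bracketSubst, pderiv_X, pderiv_one_bracket] at hp ⊢ <;> rw [hp] <;> ring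

lemma pderiv_one_pderiv_zero (P : Form) : pderiv 1 (pderiv 0 P) = pderiv 0 (pderiv 1 P) := by
  induction P using MvPolynomial.induction_on with
  | C a => simp
  | add p q hp hq => simp only [map_add, hp, hq]
  | mul_X p i hp => fin_cases i <;> simp [pderiv_X, hp, add_comm]

lemma bracketSubst_C (ξ η : Fin 2 → ℂ) (a : ℂ) : bracketSubst ξ η (C a) = C a := by
  simp [bracketSubst]

/-- Second transvectants are covariants of weight two. -/
lemma transvectant_two_bracketSubst (ξ η : Fin 2 → ℂ) (p q : ℕ) (P Q : Form) :
    transvectant p q 2 (bracketSubst ξ η P) (bracketSubst ξ η Q) =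
      C (bracketDet ξ η ^ 2) * bracketSubst ξ η (transvectant p q 2 P Q) := by
  simp only [transvectant, partialD, Finset.sum_range_succ, Finset.sum_range_zero, map_mul,
    map_add, bracketSubst_C, bracketDet, map_sub, map_pow, map_neg, map_one, map_natCast,
    Function.iterate_succ, Function.iterate_zero, Function.comp, id, map_zero, Nat.reduceSub,
    Nat.reduceAdd, pderiv_zero_bracketSubst, pderiv_one_bracketSubst, pderiv_one_pderiv_zero,
    Derivation.leibniz, pderiv_C, smul_eq_mul, Nat.choose, Nat.cast_one, Nat.cast_ofNat, map_ofNat]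
  ring

/-- Fourth transvectants are covariants of weight four. -/
lemma transvectant_four_bracketSubst (ξ η : Fin 2 → ℂ) (p q : ℕ) (P Q : Form) :
    transvectant p q 4 (bracketSubst ξ η P) (bracketSubst ξ η Q) =
      C (bracketDet ξ η ^ 4) * bracketSubst ξ η (transvectant p q 4 P Q) := by
  simp only [transvectant, partialD, Finset.sum_range_succ, Finset.sum_range_zero, map_mul,
    map_add, bracketSubst_C, bracketDet, map_sub, map_pow, map_neg, map_one, map_natCast,
    Function.iterate_succ, Function.iterate_zero, Function.comp, id, map_zero, Nat.reduceSub,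
    Nat.reduceAdd, pderiv_zero_bracketSubst, pderiv_one_bracketSubst, pderiv_one_pderiv_zero,
    Derivation.leibniz, pderiv_C, smul_eq_mul, Nat.choose, Nat.cast_one, Nat.cast_ofNat, map_ofNat]
  ring

lemma pderiv_iterate_C_mul (i : Fin 2) (n : ℕ) (c : ℂ) (F : Form) :
    (pderiv i)^[n] (C c * F) = C c * (pderiv i)^[n] F := by
  induction n generalizing F with
  | zero => rfl
  | succ n ih => simp [Function.iterate_succ, ih]

lemma transvectant_C_mul (p q k : ℕ) (c d : ℂ) (F G : Form) :
    transvectant p q k (C c * F) (C d * G) = C (c * d) * transvectant p q k F G := by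
  simp only [transvectant, partialD, pderiv_iterate_C_mul, Finset.mul_sum, map_mul]
  exact Finset.sum_congr rfl fun i _ => by ring

lemma transvectant_mul_right (p q k : ℕ) (d : ℂ) (F G : Form) :
    transvectant p q k F (C d * G) = C d * transvectant p q k F G := by
  simpa using transvectant_C_mul p q k 1 d F G

/-- Both brackets have constant term zero, so the substitution does not change `value`. -/
lemma value_bracketSubst (ξ η : Fin 2 → ℂ) (P : Form) :
    value (bracketSubst ξ η P) = value P := by
  induction P using MvPolynomial.induction_on with
  | C a => simp [bracketSubst]
  | add p q hp hq => simp [value] at hp hq ⊢; rw [hp, hq]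
  | mul_X p i hp => fin_cases i <;> simp [value, bracketSubst, bracket]

lemma value_C_mul (c : ℂ) (P : Form) : value (C c * P) = c * value P := by simp [value]

lemma covC1_bracketSubst (ξ η : Fin 2 → ℂ) (P : Form) :
    covC1 (bracketSubst ξ η P) = C (bracketDet ξ η ^ 4) * bracketSubst ξ η (covC1 P) :=
  transvectant_four_bracketSubst ..

lemma covC2_bracketSubst (ξ η : Fin 2 → ℂ) (P : Form) :
    covC2 (bracketSubst ξ η P) = C (bracketDet ξ η ^ 6) * bracketSubst ξ η (covC2 P) := by
  rw [covC2, covC1_bracketSubst, transvectant_mul_right, transvectant_two_bracketSubst,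
    ← mul_assoc, ← map_mul, ← pow_add, covC2]

lemma covC3_bracketSubst (ξ η : Fin 2 → ℂ) (P : Form) :
    covC3 (bracketSubst ξ η P) = C (bracketDet ξ η ^ 14) * bracketSubst ξ η (covC3 P) := by
  rw [covC3, covC2_bracketSubst, transvectant_C_mul, transvectant_two_bracketSubst,
    ← mul_assoc, ← map_mul, ← pow_add, ← pow_add, covC3]

lemma invJ_bracketSubst (ξ η : Fin 2 → ℂ) (P : Form) :
    invJ (bracketSubst ξ η P) = bracketDet ξ η ^ 10 * invJ P := by
  simp only [invJ, covC1_bracketSubst, transvectant_C_mul, transvectant_two_bracketSubst,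
    value_C_mul, value_bracketSubst]
  ring

lemma invK_bracketSubst (ξ η : Fin 2 → ℂ) (P : Form) :
    invK (bracketSubst ξ η P) = bracketDet ξ η ^ 20 * invK P := by
  simp only [invK, covC1_bracketSubst, covC3_bracketSubst, transvectant_C_mul,
    transvectant_two_bracketSubst, value_C_mul, value_bracketSubst]
  ring

lemma invL_bracketSubst (ξ η : Fin 2 → ℂ) (P : Form) :
    invL (bracketSubst ξ η P) = bracketDet ξ η ^ 30 * invL P := by
  simp only [invL, covC3_bracketSubst, transvectant_C_mul,
    transvectant_two_bracketSubst, value_C_mul, value_bracketSubst]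
  ring

lemma quarticS_bracketSubst (ξ η : Fin 2 → ℂ) (P : Form) :
    quarticS (bracketSubst ξ η P) = bracketDet ξ η ^ 4 * quarticS P := by
  simp only [quarticS, transvectant_four_bracketSubst, value_C_mul, value_bracketSubst]
  ring

lemma quarticT_bracketSubst (ξ η : Fin 2 → ℂ) (P : Form) :
    quarticT (bracketSubst ξ η P) = bracketDet ξ η ^ 6 * quarticT P := by
  simp only [quarticT, transvectant_two_bracketSubst, transvectant_mul_right,
    transvectant_four_bracketSubst, value_C_mul, value_bracketSubst]
  ring

/-! ### Transvectants of explicit forms -/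

/-- The binary quadratic `a x₁² + b x₁ x₂ + c x₂²`. -/
noncomputable def quadraticForm (a b c : ℂ) : Form :=
  C a * X 0 ^ 2 + C b * X 0 * X 1 + C c * X 1 ^ 2

/-- The binary cubic `a x₁³ + b x₁² x₂ + c x₁ x₂² + d x₂³`, without binomial coefficients. -/
noncomputable def cubicForm (a b c d : ℂ) : Form :=
  C a * X 0 ^ 3 + C b * X 0 ^ 2 * X 1 + C c * X 0 * X 1 ^ 2 + C d * X 1 ^ 3

/-- The binary quartic with coefficients `a, b, c, d, e`, without binomial coefficients. -/
noncomputable def quarticForm (a b c d e : ℂ) : Form :=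
  C a * X 0 ^ 4 + C b * X 0 ^ 3 * X 1 + C c * X 0 ^ 2 * X 1 ^ 2 + C d * X 0 * X 1 ^ 3 +
    C e * X 1 ^ 4

/-- The binary quintic with coefficients `a, b, c, d, e, f`, without binomial coefficients. -/
noncomputable def quinticForm (a b c d e f : ℂ) : Form :=
  C a * X 0 ^ 5 + C b * X 0 ^ 4 * X 1 + C c * X 0 ^ 3 * X 1 ^ 2 + C d * X 0 ^ 2 * X 1 ^ 3 +
    C e * X 0 * X 1 ^ 4 + C f * X 1 ^ 5

/-- The binary linear form `a x₁ + b x₂`. -/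
noncomputable def linearForm (a b : ℂ) : Form := C a * X 0 + C b * X 1

lemma pderiv_zero_linearForm (a b : ℂ) : pderiv 0 (linearForm a b) = C a := by
  simp [linearForm, pderiv_X]

lemma pderiv_one_linearForm (a b : ℂ) : pderiv 1 (linearForm a b) = C b := by
  simp [linearForm, pderiv_X]

lemma pderiv_zero_quadraticForm (a b c : ℂ) :
    pderiv 0 (quadraticForm a b c) = linearForm (2 * a) b := by
  simp [linearForm, quadraticForm, pderiv_X, map_ofNat]; ring

lemma pderiv_one_quadraticForm (a b c : ℂ) :
    pderiv 1 (quadraticForm a b c) = linearForm b (2 * c) := by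
  simp [linearForm, quadraticForm, pderiv_X, map_ofNat]; ring

lemma pderiv_zero_cubicForm (a b c d : ℂ) :
    pderiv 0 (cubicForm a b c d) = quadraticForm (3 * a) (2 * b) c := by
  simp [quadraticForm, cubicForm, pderiv_X, map_ofNat]; ring

lemma pderiv_one_cubicForm (a b c d : ℂ) :
    pderiv 1 (cubicForm a b c d) = quadraticForm b (2 * c) (3 * d) := by
  simp [quadraticForm, cubicForm, pderiv_X, map_ofNat]; ring

lemma pderiv_zero_quarticForm (a b c d e : ℂ) :
    pderiv 0 (quarticForm a b c d e) = cubicForm (4 * a) (3 * b) (2 * c) d := by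
  simp [quarticForm, cubicForm, pderiv_X, map_ofNat]; ring

lemma pderiv_one_quarticForm (a b c d e : ℂ) :
    pderiv 1 (quarticForm a b c d e) = cubicForm b (2 * c) (3 * d) (4 * e) := by
  simp [quarticForm, cubicForm, pderiv_X, map_ofNat]; ring

lemma pderiv_zero_quinticForm (a b c d e f : ℂ) :
    pderiv 0 (quinticForm a b c d e f) = quarticForm (5 * a) (4 * b) (3 * c) (2 * d) e := by
  simp [quarticForm, quinticForm, pderiv_X, map_ofNat]; ring

lemma pderiv_one_quinticForm (a b c d e f : ℂ) :
    pderiv 1 (quinticForm a b c d e f) = quarticForm b (2 * c) (3 * d) (4 * e) (5 * f) := by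
  simp [quarticForm, quinticForm, pderiv_X, map_ofNat]; ring

lemma value_transvectant_quadraticForm (a b c a' b' c' : ℂ) :
    value (transvectant 2 2 2 (quadraticForm a b c) (quadraticForm a' b' c')) =
      a * c' - b * b' / 2 + c * a' := by
  simp [value, transvectant, partialD, Finset.sum_range_succ, pderiv_zero_quadraticForm,
    pderiv_one_quadraticForm, pderiv_zero_linearForm, pderiv_one_linearForm, Nat.choose,
    Nat.factorial, map_ofNat]
  ring

lemma value_transvectant_quarticForm (a b c d e a' b' c' d' e' : ℂ) :
    value (transvectant 4 4 4 (quarticForm a b c d e) (quarticForm a' b' c' d' e')) =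
      a * e' - b * d' / 4 + c * c' / 6 - d * b' / 4 + e * a' := by
  simp [value, transvectant, partialD, Finset.sum_range_succ, pderiv_zero_quadraticForm,
    pderiv_one_quadraticForm, pderiv_zero_linearForm, pderiv_one_linearForm,
    pderiv_zero_cubicForm, pderiv_one_cubicForm, pderiv_zero_quarticForm, pderiv_one_quarticForm,
    Nat.choose, Nat.factorial, map_ofNat]
  ring

/-- The rational factor of the transvectant stays in front of integral coefficients, so that it can
be treated as an unknown constant. -/
lemma covC1_quinticForm (a b c d e f : ℂ) :
    covC1 (quinticForm a b c d e f) =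
      quadraticForm (1 / 14400 * (5760 * a * e - 2304 * b * d + 864 * c ^ 2))
        (1 / 14400 * (28800 * a * f - 3456 * b * e + 576 * c * d))
        (1 / 14400 * (5760 * b * f - 2304 * c * e + 864 * d ^ 2)) := by
  have h : (((5 - 4).factorial * (5 - 4).factorial : ℂ) /
    ((5 : ℕ).factorial * (5 : ℕ).factorial : ℂ)) = 1 / 14400 := by norm_num [Nat.factorial]
  rw [covC1, transvectant, h]
  generalize (1 / 14400 : ℂ) = κ
  simp [partialD, Finset.sum_range_succ, pderiv_zero_quadraticForm,
    pderiv_one_quadraticForm, pderiv_zero_cubicForm, pderiv_one_cubicForm,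
    pderiv_zero_quarticForm, pderiv_one_quarticForm, pderiv_zero_quinticForm,
    pderiv_one_quinticForm, Nat.choose]
  simp only [linearForm, quadraticForm, map_mul, map_add, map_sub, map_pow, map_ofNat]
  ring

lemma transvectant_quinticForm_quadraticForm (a b c d e f p q r : ℂ) :
    transvectant 5 2 2 (quinticForm a b c d e f) (quadraticForm p q r) =
      cubicForm (1 / 40 * (40 * a * r - 8 * b * q + 4 * c * p))
        (1 / 40 * (24 * b * r - 12 * c * q + 12 * d * p))
        (1 / 40 * (12 * c * r - 12 * d * q + 24 * e * p))
        (1 / 40 * (4 * d * r - 8 * e * q + 40 * f * p)) := by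
  have h : (((5 - 2).factorial * (2 - 2).factorial : ℂ) /
    ((5 : ℕ).factorial * (2 : ℕ).factorial : ℂ)) = 1 / 40 := by norm_num [Nat.factorial]
  rw [transvectant, h]
  generalize (1 / 40 : ℂ) = κ
  simp [partialD, Finset.sum_range_succ, pderiv_zero_quadraticForm,
    pderiv_one_quadraticForm, pderiv_zero_linearForm, pderiv_one_linearForm,
    pderiv_zero_quarticForm, pderiv_one_quarticForm, pderiv_zero_quinticForm,
    pderiv_one_quinticForm, Nat.choose]
  simp only [cubicForm, map_mul, map_add, map_sub, map_ofNat]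
  ring

lemma transvectant_cubicForm_self (a b c d : ℂ) :
    transvectant 3 3 2 (cubicForm a b c d) (cubicForm a b c d) =
      quadraticForm (1 / 36 * (24 * a * c - 8 * b ^ 2)) (1 / 36 * (72 * a * d - 8 * b * c))
        (1 / 36 * (24 * b * d - 8 * c ^ 2)) := by
  have h : (((3 - 2).factorial * (3 - 2).factorial : ℂ) /
    ((3 : ℕ).factorial * (3 : ℕ).factorial : ℂ)) = 1 / 36 := by norm_num [Nat.factorial]
  rw [transvectant, h]
  generalize (1 / 36 : ℂ) = κ
  simp [partialD, Finset.sum_range_succ, pderiv_zero_quadraticForm,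
    pderiv_one_quadraticForm, pderiv_zero_cubicForm, pderiv_one_cubicForm, Nat.choose]
  simp only [linearForm, quadraticForm, map_mul, map_sub, map_pow, map_ofNat]
  ring

lemma transvectant_quarticForm_self (a b c d e : ℂ) :
    transvectant 4 4 2 (quarticForm a b c d e) (quarticForm a b c d e) =
      quarticForm (1 / 144 * (48 * a * c - 18 * b ^ 2)) (1 / 144 * (144 * a * d - 24 * b * c))
        (1 / 144 * (288 * a * e + 36 * b * d - 24 * c ^ 2))
        (1 / 144 * (144 * b * e - 24 * c * d)) (1 / 144 * (48 * c * e - 18 * d ^ 2)) := by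
  have h : (((4 - 2).factorial * (4 - 2).factorial : ℂ) /
    ((4 : ℕ).factorial * (4 : ℕ).factorial : ℂ)) = 1 / 144 := by norm_num [Nat.factorial]
  rw [transvectant, h]
  generalize (1 / 144 : ℂ) = κ
  simp [partialD, Finset.sum_range_succ, pderiv_zero_cubicForm, pderiv_one_cubicForm,
    pderiv_zero_quarticForm, pderiv_one_quarticForm, Nat.choose]
  simp only [quadraticForm, quarticForm, map_mul, map_add, map_sub, map_pow, map_ofNat]
  ring

lemma quarticS_quarticForm (a b c d e : ℂ) :
    quarticS (quarticForm a b c d e) = a * e - b * d / 4 + c ^ 2 / 12 := by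
  rw [quarticS, value_transvectant_quarticForm]; ring

lemma quarticT_quarticForm (a b c d e : ℂ) :
    quarticT (quarticForm a b c d e) =
      a * c * e / 6 + b * c * d / 48 - a * d ^ 2 / 16 - b ^ 2 * e / 16 - c ^ 3 / 216 := by
  rw [quarticT, transvectant_quarticForm_self, value_transvectant_quarticForm]; ring

lemma covC1_quinticForm_zero (c₀ c₁ c₂ c₃ : ℂ) :
    covC1 (quinticForm 0 c₀ c₁ c₂ c₃ 0) =
      quadraticForm ((3 * c₁ ^ 2 - 8 * c₀ * c₂) / 50) ((c₁ * c₂ - 6 * c₀ * c₃) / 25)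
        ((3 * c₂ ^ 2 - 8 * c₁ * c₃) / 50) := by
  rw [covC1_quinticForm]; congr 1 <;> ring

lemma covC2_quinticForm_zero (c₀ c₁ c₂ c₃ : ℂ) :
    covC2 (quinticForm 0 c₀ c₁ c₂ c₃ 0) =
      cubicForm ((8 * c₀ ^ 2 * c₃ - 4 * c₀ * c₁ * c₂ + c₁ ^ 3) * 3 / 500)
        ((c₁ ^ 2 * c₂ - 2 * c₀ * c₂ ^ 2 - 4 * c₀ * c₁ * c₃) * 3 / 500)
        ((c₁ * c₂ ^ 2 - 2 * c₁ ^ 2 * c₃ - 4 * c₀ * c₂ * c₃) * 3 / 500)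
        ((8 * c₀ * c₃ ^ 2 - 4 * c₁ * c₂ * c₃ + c₂ ^ 3) * 3 / 500) := by
  rw [covC2, covC1_quinticForm_zero, transvectant_quinticForm_quadraticForm]
  congr 1 <;> ring

/-! ### Symmetric functions of the three roots of a cubic -/

/-! In this section, `c₀ x₁³ + c₁ x₁² x₂ + c₂ x₁ x₂² + c₃ x₂³` is the product of the linear forms
`uᵢ x₁ + vᵢ x₂`. For the quadratic form that remains when the `i`-th factor is omitted, `δᵢ` is the
discriminant and `mᵢ` is the product of the coefficients of `x₁²` and `x₂²`.
-/

section CubicRoots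

variable (u₁ u₂ u₃ v₁ v₂ v₃ c₀ c₁ c₂ c₃ δ₁ δ₂ δ₃ m₁ m₂ m₃ : ℂ)

lemma prod_disc_eq (h₀ : c₀ = u₁ * u₂ * u₃)
    (h₁ : c₁ = u₁ * u₂ * v₃ + u₁ * v₂ * u₃ + v₁ * u₂ * u₃)
    (h₂ : c₂ = u₁ * v₂ * v₃ + v₁ * u₂ * v₃ + v₁ * v₂ * u₃) (h₃ : c₃ = v₁ * v₂ * v₃)
    (hδ₁ : δ₁ = (u₂ * v₃ - v₂ * u₃) ^ 2) (hδ₂ : δ₂ = (u₁ * v₃ - v₁ * u₃) ^ 2)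
    (hδ₃ : δ₃ = (u₁ * v₂ - v₁ * u₂) ^ 2) (hm₁ : m₁ = u₂ * v₂ * u₃ * v₃)
    (hm₂ : m₂ = u₁ * v₁ * u₃ * v₃) (hm₃ : m₃ = u₁ * v₁ * u₂ * v₂) :
    (m₁ ^ 2 * δ₁) * (m₂ ^ 2 * δ₂) * (m₃ ^ 2 * δ₃) =
      c₀ ^ 4 * c₃ ^ 4 * (c₁ ^ 2 * c₂ ^ 2 - 4 * c₀ * c₂ ^ 3 - 4 * c₁ ^ 3 * c₃ +
        18 * c₀ * c₁ * c₂ * c₃ - 27 * c₀ ^ 2 * c₃ ^ 2) := by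
  subst_vars
  ring

lemma sum_disc_disc_cube_eq (h₀ : c₀ = u₁ * u₂ * u₃)
    (h₁ : c₁ = u₁ * u₂ * v₃ + u₁ * v₂ * u₃ + v₁ * u₂ * u₃)
    (h₂ : c₂ = u₁ * v₂ * v₃ + v₁ * u₂ * v₃ + v₁ * v₂ * u₃) (h₃ : c₃ = v₁ * v₂ * v₃)
    (hδ₁ : δ₁ = (u₂ * v₃ - v₂ * u₃) ^ 2) (hδ₂ : δ₂ = (u₁ * v₃ - v₁ * u₃) ^ 2)
    (hδ₃ : δ₃ = (u₁ * v₂ - v₁ * u₂) ^ 2) (hm₁ : m₁ = u₂ * v₂ * u₃ * v₃)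
    (hm₂ : m₂ = u₁ * v₁ * u₃ * v₃) (hm₃ : m₃ = u₁ * v₁ * u₂ * v₂) :
    (δ₁ + m₁) ^ 3 * (m₂ ^ 2 * δ₂) * (m₃ ^ 2 * δ₃) +
        (m₁ ^ 2 * δ₁) * (δ₂ + m₂) ^ 3 * (m₃ ^ 2 * δ₃) +
        (m₁ ^ 2 * δ₁) * (m₂ ^ 2 * δ₂) * (δ₃ + m₃) ^ 3 =
      c₀ ^ 2 * c₃ ^ 2 * (-216 * c₀ ^ 4 * c₃ ^ 4 + 72 * c₀ ^ 3 * c₁ * c₂ * c₃ ^ 3 +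
        19 * c₀ ^ 3 * c₂ ^ 3 * c₃ ^ 2 + 19 * c₀ ^ 2 * c₁ ^ 3 * c₃ ^ 3 +
        36 * c₀ ^ 2 * c₁ ^ 2 * c₂ ^ 2 * c₃ ^ 2 - 48 * c₀ ^ 2 * c₁ * c₂ ^ 4 * c₃ +
        8 * c₀ ^ 2 * c₂ ^ 6 - 48 * c₀ * c₁ ^ 4 * c₂ * c₃ ^ 2 + 37 * c₀ * c₁ ^ 3 * c₂ ^ 3 * c₃ -
        6 * c₀ * c₁ ^ 2 * c₂ ^ 5 + 8 * c₁ ^ 6 * c₃ ^ 2 - 6 * c₁ ^ 5 * c₂ ^ 2 * c₃ +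
        c₁ ^ 4 * c₂ ^ 4) := by
  subst_vars
  ring

lemma sum_disc_cube_cube_eq (h₀ : c₀ = u₁ * u₂ * u₃)
    (h₁ : c₁ = u₁ * u₂ * v₃ + u₁ * v₂ * u₃ + v₁ * u₂ * u₃)
    (h₂ : c₂ = u₁ * v₂ * v₃ + v₁ * u₂ * v₃ + v₁ * v₂ * u₃) (h₃ : c₃ = v₁ * v₂ * v₃)
    (hδ₁ : δ₁ = (u₂ * v₃ - v₂ * u₃) ^ 2) (hδ₂ : δ₂ = (u₁ * v₃ - v₁ * u₃) ^ 2)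
    (hδ₃ : δ₃ = (u₁ * v₂ - v₁ * u₂) ^ 2) (hm₁ : m₁ = u₂ * v₂ * u₃ * v₃)
    (hm₂ : m₂ = u₁ * v₁ * u₃ * v₃) (hm₃ : m₃ = u₁ * v₁ * u₂ * v₂) :
    (m₁ ^ 2 * δ₁) * (δ₂ + m₂) ^ 3 * (δ₃ + m₃) ^ 3 +
        (δ₁ + m₁) ^ 3 * (m₂ ^ 2 * δ₂) * (δ₃ + m₃) ^ 3 +
        (δ₁ + m₁) ^ 3 * (δ₂ + m₂) ^ 3 * (m₃ ^ 2 * δ₃) =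
      -576 * c₀ ^ 6 * c₃ ^ 6 + 784 * c₀ ^ 5 * c₁ * c₂ * c₃ ^ 5 + 168 * c₀ ^ 5 * c₂ ^ 3 * c₃ ^ 4 +
        168 * c₀ ^ 4 * c₁ ^ 3 * c₃ ^ 5 - 1044 * c₀ ^ 4 * c₁ ^ 2 * c₂ ^ 2 * c₃ ^ 4 +
        34 * c₀ ^ 4 * c₁ * c₂ ^ 4 * c₃ ^ 3 + 19 * c₀ ^ 4 * c₂ ^ 6 * c₃ ^ 2 +
        34 * c₀ ^ 3 * c₁ ^ 4 * c₂ * c₃ ^ 4 + 667 * c₀ ^ 3 * c₁ ^ 3 * c₂ ^ 3 * c₃ ^ 3 -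
        269 * c₀ ^ 3 * c₁ ^ 2 * c₂ ^ 5 * c₃ ^ 2 + 46 * c₀ ^ 3 * c₁ * c₂ ^ 7 * c₃ -
        4 * c₀ ^ 3 * c₂ ^ 9 + 19 * c₀ ^ 2 * c₁ ^ 6 * c₃ ^ 4 -
        269 * c₀ ^ 2 * c₁ ^ 5 * c₂ ^ 2 * c₃ ^ 3 + 89 * c₀ ^ 2 * c₁ ^ 4 * c₂ ^ 4 * c₃ ^ 2 -
        11 * c₀ ^ 2 * c₁ ^ 3 * c₂ ^ 6 * c₃ + c₀ ^ 2 * c₁ ^ 2 * c₂ ^ 8 +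
        46 * c₀ * c₁ ^ 7 * c₂ * c₃ ^ 3 - 11 * c₀ * c₁ ^ 6 * c₂ ^ 3 * c₃ ^ 2 -
        4 * c₁ ^ 9 * c₃ ^ 3 + c₁ ^ 8 * c₂ ^ 2 * c₃ ^ 2 := by
  subst_vars
  ring

lemma prod_cube_eq (h₀ : c₀ = u₁ * u₂ * u₃)
    (h₁ : c₁ = u₁ * u₂ * v₃ + u₁ * v₂ * u₃ + v₁ * u₂ * u₃)
    (h₂ : c₂ = u₁ * v₂ * v₃ + v₁ * u₂ * v₃ + v₁ * v₂ * u₃) (h₃ : c₃ = v₁ * v₂ * v₃)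
    (hδ₁ : δ₁ = (u₂ * v₃ - v₂ * u₃) ^ 2) (hδ₂ : δ₂ = (u₁ * v₃ - v₁ * u₃) ^ 2)
    (hδ₃ : δ₃ = (u₁ * v₂ - v₁ * u₂) ^ 2) (hm₁ : m₁ = u₂ * v₂ * u₃ * v₃)
    (hm₂ : m₂ = u₁ * v₁ * u₃ * v₃) (hm₃ : m₃ = u₁ * v₁ * u₂ * v₂) :
    (δ₁ + m₁) ^ 3 * (δ₂ + m₂) ^ 3 * (δ₃ + m₃) ^ 3 =
      (c₁ ^ 2 * c₂ ^ 2 - 3 * c₀ * c₂ ^ 3 - 3 * c₁ ^ 3 * c₃ + 10 * c₀ * c₁ * c₂ * c₃ -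
        8 * c₀ ^ 2 * c₃ ^ 2) ^ 3 := by
  rw [← mul_pow, ← mul_pow]
  congr 1
  subst_vars
  ring

end CubicRoots

/-! ### The invariants of a quintic `x₁ x₂ (c₀ x₁³ + c₁ x₁² x₂ + c₂ x₁ x₂² + c₃ x₂³)` -/

lemma covC3_quinticForm_zero (c₀ c₁ c₂ c₃ : ℂ) :
    covC3 (quinticForm 0 c₀ c₁ c₂ c₃ 0) =
      quadraticForm
        ((-32 * c₀ ^ 2 * c₁ ^ 2 * c₃ ^ 2 + 28 * c₀ ^ 2 * c₁ * c₂ ^ 2 * c₃ -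
          48 * c₀ ^ 3 * c₂ * c₃ ^ 2 + 10 * c₀ * c₁ ^ 3 * c₂ * c₃ - 4 * c₀ * c₁ ^ 2 * c₂ ^ 3 -
          3 * c₁ ^ 5 * c₃ + c₁ ^ 4 * c₂ ^ 2 - 2 * c₀ ^ 2 * c₂ ^ 4) / 62500)
        ((-296 * c₀ ^ 2 * c₁ * c₂ * c₃ ^ 2 + 32 * c₀ ^ 2 * c₂ ^ 3 * c₃ + 288 * c₀ ^ 3 * c₃ ^ 3 +
          74 * c₀ * c₁ ^ 2 * c₂ ^ 2 * c₃ - 17 * c₀ * c₁ * c₂ ^ 4 - 17 * c₁ ^ 4 * c₂ * c₃ +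
          4 * c₁ ^ 3 * c₂ ^ 3 + 32 * c₀ * c₁ ^ 3 * c₃ ^ 2) / 62500)
        ((28 * c₀ * c₁ ^ 2 * c₂ * c₃ ^ 2 + 10 * c₀ * c₁ * c₂ ^ 3 * c₃ -
          48 * c₀ ^ 2 * c₁ * c₃ ^ 3 - 3 * c₀ * c₂ ^ 5 - 32 * c₀ ^ 2 * c₂ ^ 2 * c₃ ^ 2 -
          4 * c₁ ^ 3 * c₂ ^ 2 * c₃ + c₁ ^ 2 * c₂ ^ 4 - 2 * c₁ ^ 4 * c₃ ^ 2) / 62500) := by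
  rw [covC3, covC2_quinticForm_zero, transvectant_cubicForm_self]
  congr 1 <;> ring

lemma invJ_quinticForm_zero (c₀ c₁ c₂ c₃ : ℂ) :
    invJ (quinticForm 0 c₀ c₁ c₂ c₃ 0) =
      (9 * c₀ ^ 2 * c₃ ^ 2 - 19 * c₀ * c₁ * c₂ * c₃ + 6 * c₀ * c₂ ^ 3 + 6 * c₁ ^ 3 * c₃ -
        2 * c₁ ^ 2 * c₂ ^ 2) / 625 := by
  rw [invJ, covC1_quinticForm_zero, value_transvectant_quadraticForm]
  ring

lemma invK_quinticForm_zero (c₀ c₁ c₂ c₃ : ℂ) :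
    invK (quinticForm 0 c₀ c₁ c₂ c₃ 0) =
      (864 * c₀ ^ 4 * c₃ ^ 4 - 648 * c₀ ^ 3 * c₁ * c₂ * c₃ ^ 3 + 152 * c₀ ^ 3 * c₂ ^ 3 * c₃ ^ 2 +
        152 * c₀ ^ 2 * c₁ ^ 3 * c₃ ^ 3 + 50 * c₀ ^ 2 * c₁ ^ 2 * c₂ ^ 2 * c₃ ^ 2 -
        57 * c₀ ^ 2 * c₁ * c₂ ^ 4 * c₃ + 9 * c₀ ^ 2 * c₂ ^ 6 - 57 * c₀ * c₁ ^ 4 * c₂ * c₃ ^ 2 +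
        37 * c₀ * c₁ ^ 3 * c₂ ^ 3 * c₃ - 6 * c₀ * c₁ ^ 2 * c₂ ^ 5 + 9 * c₁ ^ 6 * c₃ ^ 2 -
        6 * c₁ ^ 5 * c₂ ^ 2 * c₃ + c₁ ^ 4 * c₂ ^ 4) / 12500000 := by
  rw [invK, covC1_quinticForm_zero, covC3_quinticForm_zero, value_transvectant_quadraticForm]
  ring

lemma invL_quinticForm_zero (c₀ c₁ c₂ c₃ : ℂ) :
    invL (quinticForm 0 c₀ c₁ c₂ c₃ 0) =
      (-27648 * c₀ ^ 6 * c₃ ^ 6 + 59904 * c₀ ^ 5 * c₁ * c₂ * c₃ ^ 5 -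
        4096 * c₀ ^ 5 * c₂ ^ 3 * c₃ ^ 4 - 4096 * c₀ ^ 4 * c₁ ^ 3 * c₃ ^ 5 -
        45632 * c₀ ^ 4 * c₁ ^ 2 * c₂ ^ 2 * c₃ ^ 4 + 7872 * c₀ ^ 4 * c₁ * c₂ ^ 4 * c₃ ^ 3 -
        64 * c₀ ^ 4 * c₂ ^ 6 * c₃ ^ 2 + 7872 * c₀ ^ 3 * c₁ ^ 4 * c₂ * c₃ ^ 4 +
        13856 * c₀ ^ 3 * c₁ ^ 3 * c₂ ^ 3 * c₃ ^ 3 - 4400 * c₀ ^ 3 * c₁ ^ 2 * c₂ ^ 5 * c₃ ^ 2 +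
        224 * c₀ ^ 3 * c₁ * c₂ ^ 7 * c₃ + 8 * c₀ ^ 3 * c₂ ^ 9 - 64 * c₀ ^ 2 * c₁ ^ 6 * c₃ ^ 4 -
        4400 * c₀ ^ 2 * c₁ ^ 5 * c₂ ^ 2 * c₃ ^ 3 - 556 * c₀ ^ 2 * c₁ ^ 4 * c₂ ^ 4 * c₃ ^ 2 +
        708 * c₀ ^ 2 * c₁ ^ 3 * c₂ ^ 6 * c₃ - 83 * c₀ ^ 2 * c₁ ^ 2 * c₂ ^ 8 +
        224 * c₀ * c₁ ^ 7 * c₂ * c₃ ^ 3 + 708 * c₀ * c₁ ^ 6 * c₂ ^ 3 * c₃ ^ 2 -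
        330 * c₀ * c₁ ^ 5 * c₂ ^ 5 * c₃ + 36 * c₀ * c₁ ^ 4 * c₂ ^ 7 + 8 * c₁ ^ 9 * c₃ ^ 3 -
        83 * c₁ ^ 8 * c₂ ^ 2 * c₃ ^ 2 + 36 * c₁ ^ 7 * c₂ ^ 4 * c₃ -
        4 * c₁ ^ 6 * c₂ ^ 6) / 250000000000 := by
  rw [invL, covC3_quinticForm_zero, value_transvectant_quadraticForm]
  ring

/-! ### The relations as a property of the roots -/

/-- The six relations that express numbers `B 0, …, B 5` by `J, K, L`. -/
def InvariantRelations (B : Fin 6 → ℂ) (J K L : ℂ) : Prop :=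
    B 0 = 5 ^ 15 / 2 ^ 40 *
        (-2 ^ 21 * K ^ 3 + 2 ^ 14 * 3 * K ^ 2 * J ^ 2 - 2 ^ 7 * 3 * K * J ^ 4 + J ^ 6) ∧
    B 1 = 5 ^ 16 / (2 ^ 35 * 3 ^ 3) *
        (2 ^ 16 * 7 * K ^ 3 - 2 ^ 10 * 23 * K ^ 2 * J ^ 2 + 2 ^ 2 * 71 * K * J ^ 4 - J ^ 6) ∧
    B 2 = 5 ^ 16 / (2 ^ 30 * 3 ^ 6) *
        (2 ^ 11 * 5 ^ 3 * L * K * J - 2 ^ 4 * 5 ^ 3 * L * J ^ 3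
          - 2 ^ 15 * 3 * K ^ 3 + 2 ^ 7 * 11 * 13 * K ^ 2 * J ^ 2
          - 3 * 131 * K * J ^ 4 + 2 * J ^ 6) ∧
    B 3 = 5 ^ 16 / (2 ^ 25 * 3 ^ 9) *
        (-2 ^ 11 * 5 ^ 4 * L ^ 2 - 2 ^ 9 * 3 * 5 ^ 3 * L * K * J
          + 2 * 5 ^ 3 * 11 * L * J ^ 3 + 2 ^ 9 * 17 * K ^ 3
          - 2 ^ 2 * 23 * 37 * K ^ 2 * J ^ 2 + 3 ^ 5 * K * J ^ 4 - 2 * J ^ 6) ∧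
    B 4 = 5 ^ 16 / (2 ^ 22 * 3 ^ 12) *
        (-2 ^ 5 * 3 ^ 2 * 5 ^ 3 * L * K * J - 5 ^ 3 * 29 * L * J ^ 3
          - 2 ^ 7 * 11 * K ^ 3 - 7 ^ 2 * 83 * K ^ 2 * J ^ 2
          - 2 ^ 2 * 59 * K * J ^ 4 + 2 ^ 2 * J ^ 6) ∧
    B 5 = 5 ^ 15 / (2 ^ 15 * 3 ^ 15) *
        (3 ^ 3 * K ^ 3 - 3 ^ 3 * K ^ 2 * J ^ 2 + 3 ^ 2 * K * J ^ 4 - J ^ 6)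

/-- The relations are isobaric: `J, K, L` have weights one, two, three and each `B i` has weight
six. -/
lemma InvariantRelations.scale {B : Fin 6 → ℂ} {J K L : ℂ} (h : InvariantRelations B J K L)
    (t : ℂ) : InvariantRelations (fun i => t ^ 6 * B i) (t * J) (t ^ 2 * K) (t ^ 3 * L) := by
  obtain ⟨h₀, h₁, h₂, h₃, h₄, h₅⟩ := h
  refine ⟨?_, ?_, ?_, ?_, ?_, ?_⟩ <;> dsimp only
  · rw [h₀]; ring
  · rw [h₁]; ring
  · rw [h₂]; ring
  · rw [h₃]; ring
  · rw [h₄]; ring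
  · rw [h₅]; ring

/-- The coefficients of `∏ i, (a i * z - b i)`, obtained from the products over
`i = 0, 1` and over `i = 2, 3, 4`. -/
lemma coeff_prod_five (a b : Fin 5 → ℂ) (p : Fin 3 → ℂ) (q : Fin 4 → ℂ)
    (hp₀ : p 0 = a 0 * a 1) (hp₁ : p 1 = -(a 0 * b 1 + b 0 * a 1)) (hp₂ : p 2 = b 0 * b 1)
    (hq₀ : q 0 = a 2 * a 3 * a 4)
    (hq₁ : q 1 = -(b 2 * a 3 * a 4 + a 2 * b 3 * a 4 + a 2 * a 3 * b 4))
    (hq₂ : q 2 = a 2 * b 3 * b 4 + b 2 * a 3 * b 4 + b 2 * b 3 * a 4)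
    (hq₃ : q 3 = -(b 2 * b 3 * b 4)) (k : Fin 6) :
    (∏ i, (Polynomial.C (a i) * Polynomial.X - Polynomial.C (b i))).coeff (5 - (k : ℕ)) =
      ![p 0 * q 0, p 0 * q 1 + p 1 * q 0, p 0 * q 2 + p 1 * q 1 + p 2 * q 0,
        p 0 * q 3 + p 1 * q 2 + p 2 * q 1, p 1 * q 3 + p 2 * q 2, p 2 * q 3] k := by
  have h : ∏ i, (Polynomial.C (a i) * Polynomial.X - Polynomial.C (b i)) =
      Polynomial.C (p 0 * q 0) * Polynomial.X ^ 5 +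
      Polynomial.C (p 0 * q 1 + p 1 * q 0) * Polynomial.X ^ 4 +
      Polynomial.C (p 0 * q 2 + p 1 * q 1 + p 2 * q 0) * Polynomial.X ^ 3 +
      Polynomial.C (p 0 * q 3 + p 1 * q 2 + p 2 * q 1) * Polynomial.X ^ 2 +
      Polynomial.C (p 1 * q 3 + p 2 * q 2) * Polynomial.X +
      Polynomial.C (p 2 * q 3) := by
    simp only [Fin.prod_univ_five, hp₀, hp₁, hp₂, hq₀, hq₁, hq₂, hq₃, map_mul, map_add, map_neg]
    ring
  rw [h]
  generalize p 0 * q 0 = r₀, p 0 * q 1 + p 1 * q 0 = r₁, p 0 * q 2 + p 1 * q 1 + p 2 * q 0 = r₂,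
    p 0 * q 3 + p 1 * q 2 + p 2 * q 1 = r₃, p 1 * q 3 + p 2 * q 2 = r₄, p 2 * q 3 = r₅
  fin_cases k <;> simp [Polynomial.coeff_X, Polynomial.coeff_C, Polynomial.coeff_X_pow]

/-- The quintic with homogeneous roots `lam` satisfies the six relations. -/
def RelationsHold (lam : Fin 5 → Fin 2 → ℂ) : Prop :=
  InvariantRelations (fun k => calB k lam) (invJ (quinticOfRoots lam))
    (invK (quinticOfRoots lam)) (invL (quinticOfRoots lam))

/-! ### Quintics with the roots `0` and `∞` -/

/-- Homogeneous roots of the quintic `x₁ x₂ ∏ (u i * x₁ + v i * x₂)`, with signs such that the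
brackets are exactly these five linear factors. -/
def normalRoots (u v : Fin 3 → ℂ) : Fin 5 → Fin 2 → ℂ :=
  ![![0, 1], ![-1, 0], ![-v 0, u 0], ![-v 1, u 1], ![-v 2, u 2]]

section NormalRoots

variable (u v : Fin 3 → ℂ)

lemma bracket_normalRoots_zero : bracket (normalRoots u v 0) = X 0 := by
  simp [bracket, normalRoots]

lemma bracket_normalRoots_one : bracket (normalRoots u v 1) = X 1 := by
  simp [bracket, normalRoots]

lemma bracket_normalRoots_two : bracket (normalRoots u v 2) = C (u 0) * X 0 + C (v 0) * X 1 := by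
  simp [bracket, normalRoots]; ring

lemma bracket_normalRoots_three : bracket (normalRoots u v 3) = C (u 1) * X 0 + C (v 1) * X 1 := by
  simp [bracket, normalRoots]; ring

lemma bracket_normalRoots_four : bracket (normalRoots u v 4) = C (u 2) * X 0 + C (v 2) * X 1 := by
  simp [bracket, normalRoots]; ring

variable {u v} {c₀ c₁ c₂ c₃ : ℂ}

lemma quinticOfRoots_normalRoots (h₀ : c₀ = u 0 * u 1 * u 2)
    (h₁ : c₁ = u 0 * u 1 * v 2 + u 0 * v 1 * u 2 + v 0 * u 1 * u 2)
    (h₂ : c₂ = u 0 * v 1 * v 2 + v 0 * u 1 * v 2 + v 0 * v 1 * u 2)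
    (h₃ : c₃ = v 0 * v 1 * v 2) :
    quinticOfRoots (normalRoots u v) = quinticForm 0 c₀ c₁ c₂ c₃ 0 := by
  subst h₀ h₁ h₂ h₃
  rw [quinticOfRoots, Fin.prod_univ_five, bracket_normalRoots_zero, bracket_normalRoots_one,
    bracket_normalRoots_two, bracket_normalRoots_three, bracket_normalRoots_four]
  simp only [quinticForm, map_mul, map_add, map_zero]
  ring

lemma quarticOmit_normalRoots_zero (h₀ : c₀ = u 0 * u 1 * u 2)
    (h₁ : c₁ = u 0 * u 1 * v 2 + u 0 * v 1 * u 2 + v 0 * u 1 * u 2)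
    (h₂ : c₂ = u 0 * v 1 * v 2 + v 0 * u 1 * v 2 + v 0 * v 1 * u 2)
    (h₃ : c₃ = v 0 * v 1 * v 2) :
    quarticOmit (normalRoots u v) 0 = quarticForm 0 c₀ c₁ c₂ c₃ := by
  subst h₀ h₁ h₂ h₃
  rw [quarticOmit, show (Finset.univ.erase 0 : Finset (Fin 5)) = {1, 2, 3, 4} by decide]
  simp only [Finset.prod_insert, Finset.prod_singleton, Finset.mem_insert, Finset.mem_singleton,
    Fin.reduceEq, or_self, not_false_eq_true, bracket_normalRoots_one,
    bracket_normalRoots_two, bracket_normalRoots_three, bracket_normalRoots_four]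
  simp only [quarticForm, map_mul, map_add, map_zero]
  ring

lemma quarticOmit_normalRoots_one (h₀ : c₀ = u 0 * u 1 * u 2)
    (h₁ : c₁ = u 0 * u 1 * v 2 + u 0 * v 1 * u 2 + v 0 * u 1 * u 2)
    (h₂ : c₂ = u 0 * v 1 * v 2 + v 0 * u 1 * v 2 + v 0 * v 1 * u 2)
    (h₃ : c₃ = v 0 * v 1 * v 2) :
    quarticOmit (normalRoots u v) 1 = quarticForm c₀ c₁ c₂ c₃ 0 := by
  subst h₀ h₁ h₂ h₃
  rw [quarticOmit, show (Finset.univ.erase 1 : Finset (Fin 5)) = {0, 2, 3, 4} by decide]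
  simp only [Finset.prod_insert, Finset.prod_singleton, Finset.mem_insert, Finset.mem_singleton,
    Fin.reduceEq, or_self, not_false_eq_true, bracket_normalRoots_zero,
    bracket_normalRoots_two, bracket_normalRoots_three, bracket_normalRoots_four]
  simp only [quarticForm, map_mul, map_add, map_zero]
  ring

lemma quarticOmit_normalRoots_two :
    quarticOmit (normalRoots u v) 2 =
      quarticForm 0 (u 1 * u 2) (u 1 * v 2 + v 1 * u 2) (v 1 * v 2) 0 := by
  rw [quarticOmit,
    show (Finset.univ.erase 2 : Finset (Fin 5)) = {0, 1, 3, 4} by decide]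
  simp only [Finset.prod_insert, Finset.prod_singleton, Finset.mem_insert, Finset.mem_singleton,
    Fin.reduceEq, or_self, not_false_eq_true, bracket_normalRoots_zero, bracket_normalRoots_one,
    bracket_normalRoots_three, bracket_normalRoots_four]
  simp only [quarticForm, map_mul, map_add, map_zero]
  ring

lemma quarticOmit_normalRoots_three :
    quarticOmit (normalRoots u v) 3 =
      quarticForm 0 (u 0 * u 2) (u 0 * v 2 + v 0 * u 2) (v 0 * v 2) 0 := by
  rw [quarticOmit,
    show (Finset.univ.erase 3 : Finset (Fin 5)) = {0, 1, 2, 4} by decide]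
  simp only [Finset.prod_insert, Finset.prod_singleton, Finset.mem_insert, Finset.mem_singleton,
    Fin.reduceEq, or_self, not_false_eq_true, bracket_normalRoots_zero, bracket_normalRoots_one,
    bracket_normalRoots_two, bracket_normalRoots_four]
  simp only [quarticForm, map_mul, map_add, map_zero]
  ring

lemma quarticOmit_normalRoots_four :
    quarticOmit (normalRoots u v) 4 =
      quarticForm 0 (u 0 * u 1) (u 0 * v 1 + v 0 * u 1) (v 0 * v 1) 0 := by
  rw [quarticOmit,
    show (Finset.univ.erase 4 : Finset (Fin 5)) = {0, 1, 2, 3} by decide]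
  simp only [Finset.prod_insert, Finset.prod_singleton, Finset.mem_insert, Finset.mem_singleton,
    Fin.reduceEq, or_self, not_false_eq_true, bracket_normalRoots_zero, bracket_normalRoots_one,
    bracket_normalRoots_two, bracket_normalRoots_three]
  simp only [quarticForm, map_mul, map_add, map_zero]
  ring

/-! ### The quartics that omit one root -/

lemma quarticS_pow_three_middle (a b c d : ℂ) :
    quarticS (quarticForm 0 (a * b) (a * d + c * b) (c * d) 0) ^ 3 =
      ((a * d - c * b) ^ 2 + a * c * b * d) ^ 3 / 1728 := by
  rw [quarticS_quarticForm]; ring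

lemma quarticDisc_middle (a b c d : ℂ) :
    quarticS (quarticForm 0 (a * b) (a * d + c * b) (c * d) 0) ^ 3 -
        27 * quarticT (quarticForm 0 (a * b) (a * d + c * b) (c * d) 0) ^ 2 =
      (a * c * b * d) ^ 2 * (a * d - c * b) ^ 2 / 256 := by
  rw [quarticS_quarticForm, quarticT_quarticForm]; ring

lemma quarticS_pow_three_left (c₀ c₁ c₂ c₃ : ℂ) :
    quarticS (quarticForm 0 c₀ c₁ c₂ c₃) ^ 3 = (c₁ ^ 2 - 3 * c₀ * c₂) ^ 3 / 1728 := by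
  rw [quarticS_quarticForm]; ring

lemma quarticS_pow_three_right (c₀ c₁ c₂ c₃ : ℂ) :
    quarticS (quarticForm c₀ c₁ c₂ c₃ 0) ^ 3 = (c₂ ^ 2 - 3 * c₁ * c₃) ^ 3 / 1728 := by
  rw [quarticS_quarticForm]; ring

lemma quarticDisc_left (c₀ c₁ c₂ c₃ : ℂ) :
    quarticS (quarticForm 0 c₀ c₁ c₂ c₃) ^ 3 - 27 * quarticT (quarticForm 0 c₀ c₁ c₂ c₃) ^ 2 =
      c₀ ^ 2 * (c₁ ^ 2 * c₂ ^ 2 - 4 * c₀ * c₂ ^ 3 - 4 * c₁ ^ 3 * c₃ +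
        18 * c₀ * c₁ * c₂ * c₃ - 27 * c₀ ^ 2 * c₃ ^ 2) / 256 := by
  rw [quarticS_quarticForm, quarticT_quarticForm]; ring

lemma quarticDisc_right (c₀ c₁ c₂ c₃ : ℂ) :
    quarticS (quarticForm c₀ c₁ c₂ c₃ 0) ^ 3 - 27 * quarticT (quarticForm c₀ c₁ c₂ c₃ 0) ^ 2 =
      c₃ ^ 2 * (c₁ ^ 2 * c₂ ^ 2 - 4 * c₀ * c₂ ^ 3 - 4 * c₁ ^ 3 * c₃ +
        18 * c₀ * c₁ * c₂ * c₃ - 27 * c₀ ^ 2 * c₃ ^ 2) / 256 := by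
  rw [quarticS_quarticForm, quarticT_quarticForm]; ring

end NormalRoots

/-- The relations for quintics with the roots `0` and `∞`: after the symmetric functions of the
other three roots have been expressed by the coefficients, they are polynomial identities. -/
lemma relationsHold_normalRoots (u v : Fin 3 → ℂ) : RelationsHold (normalRoots u v) := by
  obtain ⟨c₀, h₀⟩ : ∃ c, c = u 0 * u 1 * u 2 := ⟨_, rfl⟩
  obtain ⟨c₁, h₁⟩ : ∃ c, c = u 0 * u 1 * v 2 + u 0 * v 1 * u 2 + v 0 * u 1 * u 2 := ⟨_, rfl⟩
  obtain ⟨c₂, h₂⟩ : ∃ c, c = u 0 * v 1 * v 2 + v 0 * u 1 * v 2 + v 0 * v 1 * u 2 := ⟨_, rfl⟩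
  obtain ⟨c₃, h₃⟩ : ∃ c, c = v 0 * v 1 * v 2 := ⟨_, rfl⟩
  have e₀ := prod_disc_eq _ _ _ _ _ _ _ _ _ _ _ _ _ _ _ _ h₀ h₁ h₂ h₃ rfl rfl rfl rfl rfl rfl
  have e₁ := sum_disc_disc_cube_eq _ _ _ _ _ _ _ _ _ _ _ _ _ _ _ _ h₀ h₁ h₂ h₃
    rfl rfl rfl rfl rfl rfl
  have e₂ := sum_disc_cube_cube_eq _ _ _ _ _ _ _ _ _ _ _ _ _ _ _ _ h₀ h₁ h₂ h₃
    rfl rfl rfl rfl rfl rfl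
  have e₃ := prod_cube_eq _ _ _ _ _ _ _ _ _ _ _ _ _ _ _ _ h₀ h₁ h₂ h₃ rfl rfl rfl rfl rfl rfl
  have d₂ := quarticDisc_middle (u 1) (u 2) (v 1) (v 2)
  have d₃ := quarticDisc_middle (u 0) (u 2) (v 0) (v 2)
  have d₄ := quarticDisc_middle (u 0) (u 1) (v 0) (v 1)
  have s₂ := quarticS_pow_three_middle (u 1) (u 2) (v 1) (v 2)
  have s₃ := quarticS_pow_three_middle (u 0) (u 2) (v 0) (v 2)
  have s₄ := quarticS_pow_three_middle (u 0) (u 1) (v 0) (v 1)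
  -- The factors of the last three quartics become opaque, so that the symmetric functions
  -- `e₀, …, e₃` are used without expanding them in `u` and `v` again.
  generalize (u 1 * v 1 * u 2 * v 2) ^ 2 * (u 1 * v 2 - v 1 * u 2) ^ 2 = D₂,
    (u 0 * v 0 * u 2 * v 2) ^ 2 * (u 0 * v 2 - v 0 * u 2) ^ 2 = D₃,
    (u 0 * v 0 * u 1 * v 1) ^ 2 * (u 0 * v 1 - v 0 * u 1) ^ 2 = D₄,
    ((u 1 * v 2 - v 1 * u 2) ^ 2 + u 1 * v 1 * u 2 * v 2) ^ 3 = S₂,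
    ((u 0 * v 2 - v 0 * u 2) ^ 2 + u 0 * v 0 * u 2 * v 2) ^ 3 = S₃,
    ((u 0 * v 1 - v 0 * u 1) ^ 2 + u 0 * v 0 * u 1 * v 1) ^ 3 = S₄
    at e₀ e₁ e₂ e₃ d₂ d₃ d₄ s₂ s₃ s₄
  obtain ⟨E₀, hE₀⟩ : ∃ E, E = D₂ * D₃ * D₄ := ⟨_, rfl⟩
  obtain ⟨E₁, hE₁⟩ : ∃ E, E = S₂ * D₃ * D₄ + D₂ * S₃ * D₄ + D₂ * D₃ * S₄ := ⟨_, rfl⟩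
  obtain ⟨E₂, hE₂⟩ : ∃ E, E = D₂ * S₃ * S₄ + S₂ * D₃ * S₄ + S₂ * S₃ * D₄ := ⟨_, rfl⟩
  obtain ⟨E₃, hE₃⟩ : ∃ E, E = S₂ * S₃ * S₄ := ⟨_, rfl⟩
  rw [← hE₀] at e₀
  rw [← hE₁] at e₁
  rw [← hE₂] at e₂
  rw [← hE₃] at e₃
  obtain ⟨Δ, hΔ⟩ : ∃ Δ, Δ = c₁ ^ 2 * c₂ ^ 2 - 4 * c₀ * c₂ ^ 3 - 4 * c₁ ^ 3 * c₃ +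
    18 * c₀ * c₁ * c₂ * c₃ - 27 * c₀ ^ 2 * c₃ ^ 2 := ⟨_, rfl⟩
  obtain ⟨A, hA⟩ : ∃ A, A = c₁ ^ 2 - 3 * c₀ * c₂ := ⟨_, rfl⟩
  obtain ⟨B, hB⟩ : ∃ B, B = c₂ ^ 2 - 3 * c₁ * c₃ := ⟨_, rfl⟩
  have key := coeff_prod_five
    (fun i => quarticS (quarticOmit (normalRoots u v) i) ^ 3 -
      27 * quarticT (quarticOmit (normalRoots u v) i) ^ 2)
    (fun i => quarticS (quarticOmit (normalRoots u v) i) ^ 3)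
    ![c₀ ^ 2 * c₃ ^ 2 * Δ ^ 2 / 256 ^ 2,
      -(Δ * (c₀ ^ 2 * B ^ 3 + c₃ ^ 2 * A ^ 3)) / (256 * 1728), A ^ 3 * B ^ 3 / 1728 ^ 2]
    ![E₀ / 256 ^ 3, -E₁ / (256 ^ 2 * 1728), E₂ / (256 * 1728 ^ 2), -E₃ / 1728 ^ 3]
  simp only [quarticOmit_normalRoots_zero h₀ h₁ h₂ h₃, quarticOmit_normalRoots_one h₀ h₁ h₂ h₃,
    quarticOmit_normalRoots_two, quarticOmit_normalRoots_three, quarticOmit_normalRoots_four] at key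
  rw [quarticDisc_left, quarticDisc_right, d₂, d₃, d₄] at key
  rw [quarticS_pow_three_left, quarticS_pow_three_right, s₂, s₃, s₄, ← hΔ, ← hA, ← hB] at key
  have key' := key (by simp; ring) (by simp; ring) (by simp; ring) (by simp [hE₀]; ring)
    (by simp [hE₁]; ring) (by simp [hE₂]; ring) (by simp [hE₃]; ring)
  have hk (k : Fin 6) : calB k (normalRoots u v) = _ := key' k
  rw [RelationsHold, quinticOfRoots_normalRoots h₀ h₁ h₂ h₃, invJ_quinticForm_zero,
    invK_quinticForm_zero, invL_quinticForm_zero]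
  clear key key' hE₀ hE₁ hE₂ hE₃ d₂ d₃ d₄ s₂ s₃ s₄ h₀ h₁ h₂ h₃
  refine ⟨?_, ?_, ?_, ?_, ?_, ?_⟩ <;> dsimp only <;> rw [hk] <;> dsimp
  · rw [e₀, hΔ]; ring
  · rw [e₀, e₁, hΔ, hA, hB]; ring
  · rw [e₀, e₁, e₂, hΔ, hA, hB]; ring
  · rw [e₁, e₂, e₃, hΔ, hA, hB]; ring
  · rw [e₂, e₃, hΔ, hA, hB]; ring
  · rw [e₃, hA, hB]; ring

/-! ### Change of coordinates -/

lemma quinticOfRoots_comp (lam : Fin 5 → Fin 2 → ℂ) (σ : Equiv.Perm (Fin 5)) :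
    quinticOfRoots (lam ∘ σ) = quinticOfRoots lam :=
  Equiv.prod_comp σ fun l => bracket (lam l)

lemma quarticOmit_comp (lam : Fin 5 → Fin 2 → ℂ) (σ : Equiv.Perm (Fin 5)) (i : Fin 5) :
    quarticOmit (lam ∘ σ) i = quarticOmit lam (σ i) :=
  Finset.prod_equiv σ (by simp) (by simp)

lemma Rbar_comp (lam : Fin 5 → Fin 2 → ℂ) (σ : Equiv.Perm (Fin 5)) :
    Rbar (lam ∘ σ) = Rbar lam := by
  simp only [Rbar, quarticOmit_comp]
  exact Equiv.prod_comp σ fun i =>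
    Polynomial.C (quarticS (quarticOmit lam i) ^ 3 - 27 * quarticT (quarticOmit lam i) ^ 2) *
      Polynomial.X - Polynomial.C (quarticS (quarticOmit lam i) ^ 3)

lemma calB_comp (lam : Fin 5 → Fin 2 → ℂ) (σ : Equiv.Perm (Fin 5)) (k : Fin 6) :
    calB k (lam ∘ σ) = calB k lam := by
  rw [calB, calB, Rbar_comp]

/-- The root `ζ₁ ξ - ζ₀ η` of the linear form into which `bracketSubst ξ η` carries `(x ζ)`. -/
def substRoot (ξ η ζ : Fin 2 → ℂ) : Fin 2 → ℂ := ζ 1 • ξ - ζ 0 • η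

lemma bracket_substRoot (ξ η ζ : Fin 2 → ℂ) :
    bracket (substRoot ξ η ζ) = bracketSubst ξ η (bracket ζ) := by
  simp [bracket, bracketSubst, substRoot]
  ring

lemma quinticOfRoots_substRoot (ξ η : Fin 2 → ℂ) (lam : Fin 5 → Fin 2 → ℂ) :
    quinticOfRoots (fun l => substRoot ξ η (lam l)) = bracketSubst ξ η (quinticOfRoots lam) := by
  simp only [quinticOfRoots, map_prod, bracket_substRoot]

lemma quarticOmit_substRoot (ξ η : Fin 2 → ℂ) (lam : Fin 5 → Fin 2 → ℂ) (i : Fin 5) :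
    quarticOmit (fun l => substRoot ξ η (lam l)) i = bracketSubst ξ η (quarticOmit lam i) := by
  simp only [quarticOmit, map_prod, bracket_substRoot]

lemma Rbar_substRoot (ξ η : Fin 2 → ℂ) (lam : Fin 5 → Fin 2 → ℂ) :
    Rbar (fun l => substRoot ξ η (lam l)) = Polynomial.C (bracketDet ξ η ^ 60) * Rbar lam := by
  have h : (Polynomial.C (bracketDet ξ η ^ 60) : Polynomial ℂ) =
      ∏ _i : Fin 5, Polynomial.C (bracketDet ξ η ^ 12) := by
    simp [← pow_mul]
  rw [h, Rbar, Rbar, ← Finset.prod_mul_distrib]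
  refine Finset.prod_congr rfl fun i _ => ?_
  simp only [quarticOmit_substRoot, quarticS_bracketSubst, quarticT_bracketSubst, map_mul, map_sub,
    map_pow]
  ring

lemma calB_substRoot (ξ η : Fin 2 → ℂ) (lam : Fin 5 → Fin 2 → ℂ) (k : Fin 6) :
    calB k (fun l => substRoot ξ η (lam l)) = bracketDet ξ η ^ 60 * calB k lam := by
  rw [calB, calB, Rbar_substRoot, Polynomial.coeff_C_mul]

lemma RelationsHold.of_comp {lam : Fin 5 → Fin 2 → ℂ} (σ : Equiv.Perm (Fin 5))
    (h : RelationsHold (lam ∘ σ)) : RelationsHold lam := by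
  simpa only [RelationsHold, calB_comp, quinticOfRoots_comp] using h

lemma RelationsHold.substRoot {lam : Fin 5 → Fin 2 → ℂ} (h : RelationsHold lam)
    (ξ η : Fin 2 → ℂ) : RelationsHold (fun l => substRoot ξ η (lam l)) := by
  have := InvariantRelations.scale h (bracketDet ξ η ^ 10)
  simpa only [RelationsHold, calB_substRoot, quinticOfRoots_substRoot, invJ_bracketSubst,
    invK_bracketSubst, invL_bracketSubst, ← pow_mul] using this

/-- A substitution of determinant zero annihilates all invariants. -/
lemma relationsHold_substRoot_of_det_eq_zero {ξ η : Fin 2 → ℂ} (h : bracketDet ξ η = 0)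
    (lam : Fin 5 → Fin 2 → ℂ) : RelationsHold (fun l => substRoot ξ η (lam l)) := by
  simp [RelationsHold, InvariantRelations, calB_substRoot, quinticOfRoots_substRoot,
    invJ_bracketSubst, invK_bracketSubst, invL_bracketSubst, h]

/-- If no two of the homogeneous roots are linearly independent, they are all multiples of one
vector. -/
lemma exists_smul_of_bracketDet_eq_zero {lam : Fin 5 → Fin 2 → ℂ}
    (h : ∀ i j, bracketDet (lam i) (lam j) = 0) :
    ∃ (ξ : Fin 2 → ℂ) (t : Fin 5 → ℂ), ∀ l, lam l = t l • ξ := by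
  by_cases h0 : ∀ i, lam i = 0
  · exact ⟨0, 0, by simp [h0]⟩
  push Not at h0
  obtain ⟨i, hi⟩ := h0
  obtain ⟨m, hm⟩ := Function.ne_iff.1 hi
  refine ⟨lam i, fun l => lam l m / lam i m, fun l => ?_⟩
  have hl := h i l
  simp only [bracketDet] at hl
  ext n
  simp only [Pi.smul_apply, smul_eq_mul]
  rw [Pi.zero_apply] at hm
  rw [div_mul_eq_mul_div, eq_div_iff hm]
  fin_cases m <;> fin_cases n <;> dsimp <;> first
    | linear_combination (0 : ℂ) * hl
    | linear_combination hl
    | linear_combination -hl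

/-- Two linearly independent homogeneous roots can be moved to `0` and `∞`. -/
lemma exists_substRoot_eq {lam : Fin 5 → Fin 2 → ℂ} (h : bracketDet (lam 0) (lam 1) ≠ 0) :
    ∃ u v : Fin 3 → ℂ, lam = fun l => substRoot (lam 0) (lam 1) (normalRoots u v l) := by
  -- Cramer's rule for `ζ` in the basis `lam 0, lam 1`.
  have key : ∀ ζ : Fin 2 → ℂ, ζ = substRoot (lam 0) (lam 1)
      ![-(bracketDet (lam 0) ζ / bracketDet (lam 0) (lam 1)),
        bracketDet ζ (lam 1) / bracketDet (lam 0) (lam 1)] := by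
    intro ζ
    ext n
    simp only [substRoot, Pi.sub_apply, Pi.smul_apply, smul_eq_mul, Matrix.cons_val_zero,
      Matrix.cons_val_one]
    field_simp
    simp only [bracketDet]
    fin_cases n <;> dsimp <;> ring
  refine ⟨fun i => bracketDet (lam (![2, 3, 4] i)) (lam 1) / bracketDet (lam 0) (lam 1),
    fun i => bracketDet (lam 0) (lam (![2, 3, 4] i)) / bracketDet (lam 0) (lam 1), ?_⟩
  funext l
  fin_cases l
  · simp [substRoot, normalRoots]
  · simp [substRoot, normalRoots]
  · exact key (lam 2)
  · exact key (lam 3)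
  · exact key (lam 4)

lemma relationsHold (lam : Fin 5 → Fin 2 → ℂ) : RelationsHold lam := by
  by_cases h : ∀ i j, bracketDet (lam i) (lam j) = 0
  · obtain ⟨ξ, t, ht⟩ := exists_smul_of_bracketDet_eq_zero h
    have h' : lam = fun l => substRoot ξ 0 ![0, t l] := by
      funext l
      simp [substRoot, ht]
    rw [h']
    exact relationsHold_substRoot_of_det_eq_zero (by simp [bracketDet]) fun l => ![0, t l]
  · push Not at h
    obtain ⟨i, j, hij⟩ := h
    have hne : i ≠ j := by
      rintro rfl
      exact hij (by simp only [bracketDet]; ring)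
    obtain ⟨σ, hσ⟩ : ∃ σ : Equiv.Perm (Fin 5), σ 0 = i ∧ σ 1 = j := by
      have h0 : (0 : Fin 5) ≠ Equiv.swap 0 i j := fun h => hne <| by
        simpa using (congrArg (Equiv.swap 0 i) h)
      refine ⟨(Equiv.swap 1 (Equiv.swap 0 i j)).trans (Equiv.swap 0 i), ?_, ?_⟩
      · simp [Equiv.swap_apply_of_ne_of_ne, h0]
      · simp
    refine RelationsHold.of_comp σ ?_
    have hd : bracketDet ((lam ∘ σ) 0) ((lam ∘ σ) 1) ≠ 0 := by simpa [hσ.1, hσ.2] using hij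
    obtain ⟨u, v, huv⟩ := exists_substRoot_eq hd
    rw [huv]
    exact (relationsHold_normalRoots u v).substRoot _ _

end BinaryForms

theorem proposition3p2 (F : BinaryForms.Form) (lam : Fin 5 → Fin 2 → ℂ)
    (hF : F = BinaryForms.quinticOfRoots lam)
    (J K L : ℂ) (hJ : J = BinaryForms.invJ F) (hK : K = BinaryForms.invK F)
    (hL : L = BinaryForms.invL F) :
    BinaryForms.calB 0 lam = 5 ^ 15 / 2 ^ 40 *
        (-2 ^ 21 * K ^ 3 + 2 ^ 14 * 3 * K ^ 2 * J ^ 2 - 2 ^ 7 * 3 * K * J ^ 4 + J ^ 6) ∧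
    BinaryForms.calB 1 lam = 5 ^ 16 / (2 ^ 35 * 3 ^ 3) *
        (2 ^ 16 * 7 * K ^ 3 - 2 ^ 10 * 23 * K ^ 2 * J ^ 2 + 2 ^ 2 * 71 * K * J ^ 4 - J ^ 6) ∧
    BinaryForms.calB 2 lam = 5 ^ 16 / (2 ^ 30 * 3 ^ 6) *
        (2 ^ 11 * 5 ^ 3 * L * K * J - 2 ^ 4 * 5 ^ 3 * L * J ^ 3
          - 2 ^ 15 * 3 * K ^ 3 + 2 ^ 7 * 11 * 13 * K ^ 2 * J ^ 2
          - 3 * 131 * K * J ^ 4 + 2 * J ^ 6) ∧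
    BinaryForms.calB 3 lam = 5 ^ 16 / (2 ^ 25 * 3 ^ 9) *
        (-2 ^ 11 * 5 ^ 4 * L ^ 2 - 2 ^ 9 * 3 * 5 ^ 3 * L * K * J
          + 2 * 5 ^ 3 * 11 * L * J ^ 3 + 2 ^ 9 * 17 * K ^ 3
          - 2 ^ 2 * 23 * 37 * K ^ 2 * J ^ 2 + 3 ^ 5 * K * J ^ 4 - 2 * J ^ 6) ∧
    BinaryForms.calB 4 lam = 5 ^ 16 / (2 ^ 22 * 3 ^ 12) *
        (-2 ^ 5 * 3 ^ 2 * 5 ^ 3 * L * K * J - 5 ^ 3 * 29 * L * J ^ 3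
          - 2 ^ 7 * 11 * K ^ 3 - 7 ^ 2 * 83 * K ^ 2 * J ^ 2
          - 2 ^ 2 * 59 * K * J ^ 4 + 2 ^ 2 * J ^ 6) ∧
    BinaryForms.calB 5 lam = 5 ^ 15 / (2 ^ 15 * 3 ^ 15) *
        (3 ^ 3 * K ^ 3 - 3 ^ 3 * K ^ 2 * J ^ 2 + 3 ^ 2 * K * J ^ 4 - J ^ 6) := by
  subst hF hJ hK hL
  exact BinaryForms.relationsHold lam
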